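/- Throughout, Hilbert spaces are complex and separable, $\mathcal{L}(\cdot\,;\cdot)$ denotes bounded operators, $\mathcal{L}(\mathcal{H})=\mathcal{L}(\mathcal{H};\mathcal{H})$, and $\otimes$ is the Hilbert space tensor product. A linear map $\Phi:\mathcal{L}(\mathcal{H})\to\mathcal{L}(\mathcal{H})$ is a normal CP-map if $\Phi(X)=V^\dagger(X\otimes\mathbb{1}_E)V$ for all $X$, for some Hilbert space $\mathcal{H}_E$ and some $V\in\mathcal{L}(\mathcal{H};\mathcal{H}\otimes\mathcal{H}_E)$ (a Stinespring representation). A Kraus representation of $\Phi$ is a countable family $\{\phi_n\}_{n\in N}\subset\mathcal{L}(\mathcal{H})$ with $\Phi(X)=\sum_{n\in N}\phi_n^\dagger X\phi_n$ for all $X$, where the series converges in the strong operator topology (SOT). A weakly closed *-algebra $\mathcal{A}\subseteq\mathcal{L}(\mathcal{H})$ is a (not necessarily unital) *-subalgebra closed in the weak operator topology (WOT); it is approximately finite-dimensional (AFD) if there are finite-dimensional *-subalgebras $\mathcal{A}_1\subseteq\mathcal{A}_2\subseteq\cdots\subseteq\mathcal{A}$ whose union is WOT-dense in $\mathcal{A}$.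 Let $\mathcal{A}'$ be the commutant of $\mathcal{A}$, let $\mathcal{H}_0=\{\psi\in\mathcal{H}: X\psi=0\ \text{for all } X\in\mathcal{A}\}$, and let $P_0\in\mathcal{L}(\mathcal{H};\mathcal{H}_0)$ be the orthogonal projection onto $\mathcal{H}_0$, so that $P_0^\dagger$ is the inclusion of $\mathcal{H}_0$ in $\mathcal{H}$. **Theorem.** Let $L(X)=\Phi(X)-K^\dagger X-XK$ for $X\in\mathcal{L}(\mathcal{H})$, where $\Phi$ is a normal CP-map on $\mathcal{L}(\mathcal{H})$ and $K\in\mathcal{L}(\mathcal{H})$, and let $\mathcal{A}\subseteq\mathcal{L}(\mathcal{H})$ be an AFD weakly closed *-algebra. The following are equivalent. 1. $L(\mathcal{A})\subseteq\mathcal{A}$. 2. (Stinespring) For every (equivalently, for some) Stinespring representation $\Phi(X)=V^\dagger(X\otimes\mathbb{1}_E)V$ there exist $V_0\in\mathcal{L}(\mathcal{H};\mathcal{H}_0\otimes\mathcal{H}_E)$, $A,B\in\mathcal{L}(\mathcal{H};\mathcal{H}\otimes\mathcal{H}_E)$, $K_0\in\mathcal{L}(\mathcal{H};\mathcal{H}_0)$,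 $K_{\mathcal{A}}\in\mathcal{A}$ and a self-adjoint $H_{\mathcal{A}'}\in\mathcal{A}'$ such that $A^\dagger(X\otimes\mathbb{1}_E)A\in\mathcal{A}$ and $(X\otimes\mathbb{1}_E)B=BX$ for all $X\in\mathcal{A}$, and $$V=(P_0^\dagger\otimes\mathbb{1}_E)V_0+A+B,\qquad K=B^\dagger A+\tfrac12B^\dagger B+K_{\mathcal{A}}+iH_{\mathcal{A}'}+P_0^\dagger K_0.$$ 3. (Kraus) For every (equivalently, for some) Kraus representation $\Phi(X)=\sum_{n\in N}\phi_n^\dagger X\phi_n$, $N$ countable, there exist $\{v_n\}_{n\in N}\subset\mathcal{L}(\mathcal{H};\mathcal{H}_0)$ and $\{a_n\}_{n\in N},\{b_n\}_{n\in N}\subset\mathcal{L}(\mathcal{H})$ such that $\sum_n v_n^\dagger v_n$, $\sum_n a_n^\dagger a_n$ and $\sum_n b_n^\dagger b_n$ converge in SOT, $K_0\in\mathcal{L}(\mathcal{H};\mathcal{H}_0)$, $K_{\mathcal{A}}\in\mathcal{A}$ and a self-adjoint $H_{\mathcal{A}'}\in\mathcal{A}'$ such that $\sum_n a_n^\dagger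 Xa_n\in\mathcal{A}$ for all $X\in\mathcal{A}$, $b_n\in\mathcal{A}'$ for all $n\in N$, and $$\phi_n=P_0^\dagger v_n+a_n+b_n\ \ (n\in N),\qquad K=\sum_{n\in N}b_n^\dagger a_n+\tfrac12\sum_{n\in N}b_n^\dagger b_n+K_{\mathcal{A}}+iH_{\mathcal{A}'}+P_0^\dagger K_0,$$ where all series converge in SOT. -/

import Mathlib

open scoped TensorProduct InnerProductSpace

universe u v w

noncomputable section

namespace GKLS

/-- The Hilbert space tensor product: the completion of the algebraic tensor product with respect
to the inner product determined by `⟪x ⊗ y, x' ⊗ y'⟫ = ⟪x, x'⟫ * ⟪y, y'⟫`. -/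
abbrev HTensor (H : Type u) [NormedAddCommGroup H] [InnerProductSpace ℂ H]
    (E : Type v) [NormedAddCommGroup E] [InnerProductSpace ℂ E] : Type (max u v) :=
  UniformSpace.Completion (H ⊗[ℂ] E)

/-- The bounded operator `S ⊗ 𝟙_E : H₁ ⊗ E → H₂ ⊗ E`. -/
def ampl {H₁ : Type u} [NormedAddCommGroup H₁] [InnerProductSpace ℂ H₁]
    {H₂ : Type u} [NormedAddCommGroup H₂] [InnerProductSpace ℂ H₂]
    (E : Type v) [NormedAddCommGroup E] [InnerProductSpace ℂ E]
    (S : H₁ →L[ℂ] H₂) : HTensor H₁ E →L[ℂ] HTensor H₂ E :=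
  (S.rTensor E).completion

/-- `S ⊗ 𝟙_E` acts on elementary tensors as expected. -/
theorem ampl_tmul {H₁ : Type u} [NormedAddCommGroup H₁] [InnerProductSpace ℂ H₁]
    {H₂ : Type u} [NormedAddCommGroup H₂] [InnerProductSpace ℂ H₂]
    (E : Type v) [NormedAddCommGroup E] [InnerProductSpace ℂ E]
    (S : H₁ →L[ℂ] H₂) (x : H₁) (e : E) :
    ampl E S ((x ⊗ₜ[ℂ] e : H₁ ⊗[ℂ] E) : HTensor H₁ E)
      = ((S x ⊗ₜ[ℂ] e : H₂ ⊗[ℂ] E) : HTensor H₂ E) := by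
  simp [ampl]

section

variable {H : Type u} [NormedAddCommGroup H] [InnerProductSpace ℂ H] [CompleteSpace H]

/-- A (not necessarily unital) *-subalgebra of the bounded operators is weakly closed if it is
closed in the weak operator topology. -/
def IsWeaklyClosed (𝒜 : NonUnitalStarSubalgebra ℂ (H →L[ℂ] H)) : Prop :=
  IsClosed {T : H →WOT[ℂ] H | ContinuousLinearMapWOT.toCLM T ∈ 𝒜}

/-- `𝒜` is approximately finite-dimensional: there is an increasing sequence of finite-dimensional
sub-*-algebras of `𝒜` whose union is dense in `𝒜` in the weak operator topology. -/
def IsAFD (𝒜 : NonUnitalStarSubalgebra ℂ (H →L[ℂ] H)) : Prop :=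
  ∃ 𝒜s : ℕ → NonUnitalStarSubalgebra ℂ (H →L[ℂ] H),
    Monotone 𝒜s ∧ (∀ n, 𝒜s n ≤ 𝒜) ∧ (∀ n, FiniteDimensional ℂ (𝒜s n)) ∧
    ∀ T : H →WOT[ℂ] H, ContinuousLinearMapWOT.toCLM T ∈ 𝒜 →
      T ∈ closure {S : H →WOT[ℂ] H | ∃ n, ContinuousLinearMapWOT.toCLM S ∈ 𝒜s n}

/-- The commutant `𝒜'`. -/
def commutant (𝒜 : NonUnitalStarSubalgebra ℂ (H →L[ℂ] H)) : Set (H →L[ℂ] H) :=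
  {X | ∀ Y ∈ 𝒜, X * Y = Y * X}

/-- The subspace `H₀` of `H` on which `𝒜` vanishes. A weakly closed *-algebra is the direct sum of
the zero algebra on `H₀` and a von Neumann algebra on the orthogonal complement of `H₀`. -/
def nullSpace (𝒜 : NonUnitalStarSubalgebra ℂ (H →L[ℂ] H)) : Submodule ℂ H where
  carrier := {ψ | ∀ X ∈ 𝒜, X ψ = 0}
  zero_mem' := by intro X _; simp
  add_mem' := by intro a b ha hb X hX; simp [ha X hX, hb X hX]
  smul_mem' := by intro c a ha X hX; simp [ha X hX]

theorem isClosed_nullSpace (𝒜 : NonUnitalStarSubalgebra ℂ (H →L[ℂ] H)) :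
    IsClosed (nullSpace 𝒜 : Set H) := by
  have h : (nullSpace 𝒜 : Set H) = ⋂ X ∈ 𝒜, {ψ : H | X ψ = 0} := by
    ext ψ; simp [nullSpace]
  rw [h]
  exact isClosed_biInter fun X _ => isClosed_eq X.continuous continuous_const

instance completeSpace_nullSpace (𝒜 : NonUnitalStarSubalgebra ℂ (H →L[ℂ] H)) :
    CompleteSpace (nullSpace 𝒜) :=
  (isClosed_nullSpace 𝒜).completeSpace_coe

/-- The orthogonal projection `P₀ : H → H₀`; its adjoint is the inclusion `H₀ → H`. -/
def P₀ (𝒜 : NonUnitalStarSubalgebra ℂ (H →L[ℂ] H)) : H →L[ℂ] nullSpace 𝒜 :=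
  (nullSpace 𝒜).orthogonalProjectionOnto

/-- `(V, E)` is a Stinespring representation of `Φ`: `Φ X = V† (X ⊗ 𝟙_E) V`. -/
def IsStinespring {E : Type v} [NormedAddCommGroup E] [InnerProductSpace ℂ E]
    (Φ : (H →L[ℂ] H) →ₗ[ℂ] (H →L[ℂ] H)) (V : H →L[ℂ] HTensor H E) : Prop :=
  ∀ X : H →L[ℂ] H, Φ X = V.adjoint ∘L ampl E X ∘L V

/-- `Φ` is a normal CP-map: it has a Stinespring representation on a separable Hilbert space. -/
def IsNormalCP (Φ : (H →L[ℂ] H) →ₗ[ℂ] (H →L[ℂ] H)) : Prop :=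
  ∃ (E : Type v) (_ : NormedAddCommGroup E) (_ : InnerProductSpace ℂ E) (_ : CompleteSpace E)
    (_ : TopologicalSpace.SeparableSpace E) (V : H →L[ℂ] HTensor H E), IsStinespring Φ V

/-- The series `∑ₙ fₙ` converges to `S` in the strong operator topology,
regardless of the order of the terms. -/
def HasSumSOT {N : Type w} (f : N → H →L[ℂ] H) (S : H →L[ℂ] H) : Prop :=
  ∀ ψ : H, HasSum (fun n => f n ψ) (S ψ)

/-- The series `∑ₙ fₙ` converges in the strong operator topology. -/
def SummableSOT {N : Type w} (f : N → H →L[ℂ] H) : Prop :=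
  ∃ S : H →L[ℂ] H, HasSumSOT f S

/-- `(φₙ)` is a Kraus representation of `Φ`: `Φ X = ∑ₙ φₙ† X φₙ`. -/
def IsKraus {N : Type w} (Φ : (H →L[ℂ] H) →ₗ[ℂ] (H →L[ℂ] H)) (φ : N → H →L[ℂ] H) : Prop :=
  ∀ X : H →L[ℂ] H, HasSumSOT (fun n => (φ n).adjoint ∘L X ∘L φ n) (Φ X)

/-- The normal form of the pair `(V, K)`:
`V = (P₀† ⊗ 𝟙) V₀ + A + B` and `K = B†A + ½ B†B + K_𝒜 + i H_𝒜' + P₀† K₀`. -/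
def StinespringForm {E : Type v} [NormedAddCommGroup E] [InnerProductSpace ℂ E]
    (𝒜 : NonUnitalStarSubalgebra ℂ (H →L[ℂ] H))
    (V : H →L[ℂ] HTensor H E) (K : H →L[ℂ] H) : Prop :=
  ∃ (V₀ : H →L[ℂ] HTensor (nullSpace 𝒜) E) (A B : H →L[ℂ] HTensor H E)
    (K₀ : H →L[ℂ] nullSpace 𝒜) (KA HA' : H →L[ℂ] H),
    KA ∈ 𝒜 ∧ HA' ∈ commutant 𝒜 ∧ IsSelfAdjoint HA' ∧
    (∀ X ∈ 𝒜, A.adjoint ∘L ampl E X ∘L A ∈ 𝒜) ∧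
    (∀ X ∈ 𝒜, ampl E X ∘L B = B ∘L X) ∧
    V = ampl E (P₀ 𝒜).adjoint ∘L V₀ + A + B ∧
    K = B.adjoint ∘L A + (1 / 2 : ℂ) • (B.adjoint ∘L B) + KA + Complex.I • HA'
      + (P₀ 𝒜).adjoint ∘L K₀

/-- The normal form of the pair `((φₙ), K)`: `φₙ = P₀† vₙ + aₙ + bₙ` and
`K = ∑ₙ bₙ† aₙ + ½ ∑ₙ bₙ† bₙ + K_𝒜 + i H_𝒜' + P₀† K₀`; the two series in `K` converge to `Sba`
and `Sbb`. -/
def KrausForm {N : Type w} (𝒜 : NonUnitalStarSubalgebra ℂ (H →L[ℂ] H))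
    (φ : N → H →L[ℂ] H) (K : H →L[ℂ] H) : Prop :=
  ∃ (v : N → H →L[ℂ] nullSpace 𝒜) (a b : N → H →L[ℂ] H)
    (K₀ : H →L[ℂ] nullSpace 𝒜) (KA HA' Sba Sbb : H →L[ℂ] H),
    SummableSOT (fun n => (v n).adjoint ∘L v n) ∧
    SummableSOT (fun n => (a n).adjoint ∘L a n) ∧
    HasSumSOT (fun n => (b n).adjoint ∘L b n) Sbb ∧
    HasSumSOT (fun n => (b n).adjoint ∘L a n) Sba ∧
    KA ∈ 𝒜 ∧ HA' ∈ commutant 𝒜 ∧ IsSelfAdjoint HA' ∧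
    (∀ X ∈ 𝒜, ∃ Y ∈ 𝒜, HasSumSOT (fun n => (a n).adjoint ∘L X ∘L a n) Y) ∧
    (∀ n, b n ∈ commutant 𝒜) ∧
    (∀ n, φ n = (P₀ 𝒜).adjoint ∘L v n + a n + b n) ∧
    K = Sba + (1 / 2 : ℂ) • Sbb + KA + Complex.I • HA' + (P₀ 𝒜).adjoint ∘L K₀

end

end GKLS

end

/-! Write `π X = X ⊗ 𝟙` and `D X = π X V - V X`. The defect of `L` from being a derivation, `L(Y†XZ)
- L(Y†X)Z - Y†L(XZ) + Y†L(X)Z`, equals `(D Y)† π(X) D(Z)`: all terms with `K` cancel. Invariance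
therefore puts these products in `𝒜`.

If `D` were inner, `D X = π(X)A - A X`, then `B = V - A` would intertwine `X` and `π X`. Approximate
finite-dimensionality supplies such a `B`: average `π(U) V U†` over the compact unitary groups of
the finite-dimensional algebras (with unit adjoined) and take a weak limit. This is
`exists_intertwiner`, which also shows that `V - B` lies in every weakly closed subspace containing
all `D X` and `π(X) D(Y)`. Applied twice, it replaces both factors `D` above by `V - B`, so `(V -
B)† π(X) (V - B) ∈ 𝒜`. Cutting down by the unit `P` of `𝒜` splits off the null-space part
(`exists_form_of_invariant`).

By `generator_eq`, the rest `G` of `K` satisfies `G†X + XG ∈ 𝒜`. The same averaging with `π = id`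
decomposes `G` (`exists_sum_of_invariant`). The converse is `invariant_of_form`. The Kraus
statements are the Stinespring ones read in components along a Hilbert basis of `E`. -/

noncomputable section

namespace GKLS

section

open Filter Topology MeasureTheory ContinuousLinearMapWOT

/-! ### Compactness in the weak operator topology. -/

section WeakLimits

variable {H : Type*} [NormedAddCommGroup H] [InnerProductSpace ℂ H]
variable {M : Type*} [NormedAddCommGroup M] [InnerProductSpace ℂ M] [CompleteSpace M]

/-- Bounded families of operators converge along ultrafilters in the weak operator topology. -/
theorem exists_tendsto_wot {ι : Type*} (F : Ultrafilter ι) (f : ι → H →L[ℂ] M) (C : ℝ)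
    (hC : ∀ᶠ i in (F : Filter ι), ‖f i‖ ≤ C) :
    ∃ T : H →WOT[ℂ] M, Tendsto (fun i => ofCLM (f i)) F (𝓝 T) := by
  have hb : ∀ x y, ∀ᶠ i in (F : Filter ι), ‖⟪f i x, y⟫_ℂ‖ ≤ C * ‖x‖ * ‖y‖ := fun x y =>
    hC.mono fun i hi => (norm_inner_le_norm _ _).trans
      (mul_le_mul_of_nonneg_right ((f i).le_of_opNorm_le hi x) (norm_nonneg y))
  have hlim : ∀ x y, ∃ z ∈ Metric.closedBall (0 : ℂ) (C * ‖x‖ * ‖y‖),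
      Tendsto (fun i => ⟪f i x, y⟫_ℂ) F (𝓝 z) := fun x y =>
    (isCompact_closedBall _ _).ultrafilter_le_nhds (F.map fun i => ⟪f i x, y⟫_ℂ)
      (by
        rw [Ultrafilter.coe_map, le_principal_iff, mem_map]
        exact (hb x y).mono fun i hi => by simpa using hi)
  choose b hb' hlim using hlim
  -- The limits of the matrix elements form a bounded sesquilinear form, which the Riesz theorem
  -- turns into an operator.
  let B : H →ₗ⋆[ℂ] M →ₗ[ℂ] ℂ := LinearMap.mk₂'ₛₗ _ _ b
    (fun x x' y => tendsto_nhds_unique (hlim _ _)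
      (by simpa [inner_add_left] using (hlim x y).add (hlim x' y)))
    (fun c x y => tendsto_nhds_unique (hlim _ _)
      (by simpa [inner_smul_left, mul_comm] using (hlim x y).const_mul (starRingEnd ℂ c)))
    (fun x y y' => tendsto_nhds_unique (hlim _ _)
      (by simpa [inner_add_right] using (hlim x y).add (hlim x y')))
    (fun c x y => tendsto_nhds_unique (hlim _ _)
      (by simpa [inner_smul_right] using (hlim x y).const_mul c))
  let T : H →L[ℂ] M :=
    (InnerProductSpace.toDual ℂ M).symm.toContinuousLinearEquiv.toContinuousLinearMap.comp
      (B.mkContinuous₂ C fun x y => by simpa only [B, LinearMap.mk₂'ₛₗ_apply, mem_closedBall_zero_iff] using hb' x y)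
  refine ⟨ofCLM T, tendsto_iff_forall_inner_apply_tendsto.2 fun x y => ?_⟩
  have h1 : ⟪T x, y⟫_ℂ = b x y := by
    simp [T, B]
  have h2 := (Complex.continuous_conj.tendsto _).comp (hlim x y)
  rw [← h1, inner_conj_symm] at h2
  refine h2.congr fun i => ?_
  simp

theorem continuous_ofCLM : Continuous (ofCLM : (H →L[ℂ] M) → H →WOT[ℂ] M) :=
  ContinuousLinearMapWOT.continuous_iff.2 fun x y =>
    ((innerSL ℂ y).comp (ContinuousLinearMap.apply ℂ M x)).continuous

theorem isClosed_of_isClosed_wot {S : Set (H →L[ℂ] M)}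
    (hS : IsClosed {T : H →WOT[ℂ] M | toCLM T ∈ S}) : IsClosed S :=
  hS.preimage continuous_ofCLM

end WeakLimits

/-! ### Averaging over unitary groups and intertwiners for AFD algebras. -/

section Averaging

variable {H : Type*} [NormedAddCommGroup H] [InnerProductSpace ℂ H] [CompleteSpace H]
variable {M : Type*} [NormedAddCommGroup M] [InnerProductSpace ℂ M] [CompleteSpace M]

theorem norm_le_one_of_star_mul_self {U : H →L[ℂ] H} (hU : star U * U = 1) : ‖U‖ ≤ 1 := by
  have h := CStarRing.norm_star_mul_self (x := U)
  rw [hU] at h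
  have h1 : ‖(1 : H →L[ℂ] H)‖ ≤ 1 := ContinuousLinearMap.norm_id_le
  nlinarith [norm_nonneg U]

/-- Averaging an operator over the unitary group of a finite-dimensional *-algebra. -/
theorem exists_average (ℬ : StarSubalgebra ℂ (H →L[ℂ] H)) [FiniteDimensional ℂ ℬ]
    (π : (H →L[ℂ] H) →⋆ₐ[ℂ] (M →L[ℂ] M)) (V : H →L[ℂ] M) :
    ∃ B : H →L[ℂ] M, ‖B‖ ≤ ‖V‖ ∧ (∀ X ∈ ℬ, π X ∘L B = B ∘L X) ∧
      ∀ 𝒯 : Submodule ℂ (H →L[ℂ] M), IsClosed (𝒯 : Set (H →L[ℂ] M)) →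
        (∀ U ∈ ℬ, U * star U = 1 → V - π U ∘L V ∘L star U ∈ 𝒯) → V - B ∈ 𝒯 := by
  have hcl : IsClosed (ℬ : Set (H →L[ℂ] H)) :=
    (Subalgebra.toSubmodule ℬ.toSubalgebra).closed_of_finiteDimensional
  let _ : MeasurableSpace (unitary ℬ) := borel _
  have : BorelSpace (unitary ℬ) := ⟨rfl⟩
  have : ProperSpace ℬ := FiniteDimensional.proper ℂ ℬ
  have : CompactSpace (unitary ℬ) := by
    refine isCompact_iff_compactSpace.1 (Metric.isCompact_of_isClosed_isBounded
      (s := (unitary ℬ : Set ℬ)) isClosed_unitary ?_)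
    refine (Metric.isBounded_closedBall (x := (0 : ℬ)) (r := 1)).subset fun u hu => ?_
    rw [mem_closedBall_zero_iff]
    exact norm_le_one_of_star_mul_self (congrArg Subtype.val hu.1)
  have : SecondCountableTopology ℬ := inferInstance
  let μ : Measure (unitary ℬ) := Measure.haarMeasure ⊤
  have : IsProbabilityMeasure μ := ⟨Measure.haarMeasure_self⟩
  let f : unitary ℬ → H →L[ℂ] M := fun u => π ((u : ℬ) : H →L[ℂ] H) ∘L V ∘L star ((u : ℬ) : H →L[ℂ] H)
  have hπ : Continuous π := map_continuous π
  have hcoe : Continuous fun u : unitary ℬ => ((u : ℬ) : H →L[ℂ] H) :=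
    continuous_subtype_val.comp continuous_subtype_val
  have hfc : Continuous f :=
    (hπ.comp hcoe).clm_comp (continuous_const.clm_comp (continuous_star.comp hcoe))
  have hfn : ∀ u, ‖f u‖ ≤ ‖V‖ := by
    intro u
    have h1 : ‖((u : ℬ) : H →L[ℂ] H)‖ ≤ 1 :=
      norm_le_one_of_star_mul_self (congrArg Subtype.val u.2.1)
    calc ‖f u‖ ≤ ‖π ((u : ℬ) : H →L[ℂ] H)‖ * (‖V‖ * ‖star ((u : ℬ) : H →L[ℂ] H)‖) :=
          (ContinuousLinearMap.opNorm_comp_le _ _).trans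
            (mul_le_mul_of_nonneg_left (ContinuousLinearMap.opNorm_comp_le _ _) (norm_nonneg _))
      _ ≤ 1 * (‖V‖ * 1) := by
          rw [norm_star]
          gcongr
          exact (NonUnitalStarAlgHom.norm_apply_le π _).trans h1
      _ = ‖V‖ := by simp
  have hfi : Integrable f μ := hfc.integrable_of_hasCompactSupport (HasCompactSupport.of_compactSpace f)
  refine ⟨∫ u, f u ∂μ, ?_, ?_, ?_⟩
  · simpa using norm_integral_le_of_norm_le_const (μ := μ) (Eventually.of_forall hfn)
  · have hunit : ∀ w : unitary ℬ, π ((w : ℬ) : H →L[ℂ] H) ∘L (∫ u, f u ∂μ)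
        = (∫ u, f u ∂μ) ∘L ((w : ℬ) : H →L[ℂ] H) := by
      intro w
      have hw : star ((w : ℬ) : H →L[ℂ] H) * ((w : ℬ) : H →L[ℂ] H) = 1 :=
        congrArg Subtype.val w.2.1
      let c : (H →L[ℂ] M) →L[ℂ] (H →L[ℂ] M) :=
        (ContinuousLinearMap.compL ℂ H M M (π ((w : ℬ) : H →L[ℂ] H))).comp
          ((ContinuousLinearMap.compL ℂ H H M).flip (star ((w : ℬ) : H →L[ℂ] H)))
      have h1 : c (∫ u, f u ∂μ) = ∫ u, f u ∂μ := by
        -- Left invariance of Haar measure, since `π(w) f(u) w† = f(wu)`.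
        rw [← c.integral_comp_comm hfi, ← integral_mul_left_eq_self f w]
        congr 1 with u x
        simp [c, f]
      have h2 : c (∫ u, f u ∂μ)
        = π ((w : ℬ) : H →L[ℂ] H) ∘L (∫ u, f u ∂μ) ∘L star ((w : ℬ) : H →L[ℂ] H) := rfl
      conv_rhs => rw [← h1, h2]
      rw [ContinuousLinearMap.comp_assoc, ContinuousLinearMap.comp_assoc,
        ← ContinuousLinearMap.mul_def, hw]
      rfl
    intro X hX
    suffices h : ∀ x : ℬ, π (x : H →L[ℂ] H) ∘L (∫ u, f u ∂μ)
        = (∫ u, f u ∂μ) ∘L (x : H →L[ℂ] H) from h ⟨X, hX⟩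
    intro x
    -- The unitaries of a unital C*-algebra span it, so intertwining for unitaries suffices.
    have hspan : x ∈ Submodule.span ℂ (unitary ℬ : Set ℬ) := by
      rw [CStarAlgebra.span_unitary]; trivial
    induction hspan using Submodule.span_induction with
    | mem x h => exact hunit ⟨x, h⟩
    | zero => simp
    | add x y _ _ hx hy => simp [ContinuousLinearMap.add_comp, hx, hy]
    | smul a x _ hx => simp [ContinuousLinearMap.smul_comp, hx]
  · intro 𝒯 h𝒯 hU
    have h1 : V - ∫ u, f u ∂μ = ∫ u, (V - f u) ∂μ := by
      rw [integral_sub (integrable_const _) hfi]; simp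
    rw [h1]
    refine Convex.integral_mem (s := (𝒯 : Set (H →L[ℂ] M))) (𝒯.restrictScalars ℝ).convex h𝒯
      (Eventually.of_forall fun u => ?_) ((integrable_const _).sub hfi)
    exact hU _ (u : ℬ).2 (congrArg Subtype.val u.2.2)

/-- For an AFD algebra, every operator can be averaged to an operator intertwining the identity
representation with `π`; the difference is generated by the derivation `X ↦ π X V - V X`. -/
theorem exists_intertwiner {𝒜 : NonUnitalStarSubalgebra ℂ (H →L[ℂ] H)} (hAFD : IsAFD 𝒜)
    (π : (H →L[ℂ] H) →⋆ₐ[ℂ] (M →L[ℂ] M)) {ι : Type*} (R : ι → H →L[ℂ] M)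
    (hR : ∀ X i, π X ∘L R i = R i ∘L X)
    (hR0 : ∀ m, (∀ i, (R i).adjoint m = 0) → m = 0) (V : H →L[ℂ] M) :
    ∃ B : H →L[ℂ] M, (∀ X ∈ 𝒜, π X ∘L B = B ∘L X) ∧
      ∀ 𝒯 : Submodule ℂ (H →L[ℂ] M), IsClosed {T : H →WOT[ℂ] M | toCLM T ∈ 𝒯} →
        (∀ X ∈ 𝒜, π X ∘L V - V ∘L X ∈ 𝒯) →
        (∀ X ∈ 𝒜, ∀ Y ∈ 𝒜, π X ∘L (π Y ∘L V - V ∘L Y) ∈ 𝒯) → V - B ∈ 𝒯 := by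
  obtain ⟨𝒜s, hmono, hle, hfin, hdense⟩ := hAFD
  have hfd : ∀ n, FiniteDimensional ℂ (StarAlgebra.adjoin ℂ (𝒜s n : Set (H →L[ℂ] H))) := by
    intro n
    have := hfin n
    rw [← NonUnitalStarSubalgebra.unitization_range]
    have : FiniteDimensional ℂ (Unitization ℂ (𝒜s n)) :=
      Module.Finite.equiv (Unitization.linearEquiv ℂ ℂ (𝒜s n)).symm
    exact LinearMap.finiteDimensional_range
      (NonUnitalStarSubalgebra.unitization (𝒜s n)).toAlgHom.toLinearMap
  choose B hBn hB hB𝒯 using fun n =>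
    exists_average (StarAlgebra.adjoin ℂ (𝒜s n : Set (H →L[ℂ] H))) π V
  let F : Ultrafilter ℕ := hyperfilter ℕ
  obtain ⟨B', hB'⟩ := exists_tendsto_wot F B ‖V‖ (Eventually.of_forall hBn)
  have hF : (F : Filter ℕ) ≤ atTop := Nat.hyperfilter_le_atTop
  rw [tendsto_iff_forall_inner_apply_tendsto] at hB'
  have hint : ∀ n, ∀ X ∈ 𝒜s n, π X ∘L toCLM B' = toCLM B' ∘L X := by
    intro n X hX
    ext x
    refine ext_inner_left ℂ fun y => ?_
    refine tendsto_nhds_unique (f := fun k => ⟪y, (π X ∘L B k) x⟫_ℂ) (l := F) ?_ ?_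
    · simpa [ContinuousLinearMap.adjoint_inner_left] using hB' x ((π X).adjoint y)
    · refine (hB' (X x) y).congr' ?_
      filter_upwards [hF (eventually_ge_atTop n)] with k hk
      rw [hB k X (StarAlgebra.subset_adjoin ℂ _ (hmono hk hX))]
      rfl
  refine ⟨toCLM B', fun X hX => ?_, fun 𝒯 h𝒯 h1 h2 => ?_⟩
  -- The map `π` is not assumed weakly continuous. Testing against the separating family `R i`
  -- repairs this: `(R i)† π(X) = X (R i)†` depends weakly continuously on `X`, so the relation
  -- extends from the union to its closure.
  · have hcl : IsClosed {T : H →WOT[ℂ] H | ∀ i x y, ⟪y, T ((R i).adjoint (B' x))⟫_ℂ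
        = ⟪y, (R i).adjoint (B' (T x))⟫_ℂ} := by
      simp only [Set.ofPred_forall]
      refine isClosed_iInter fun i => isClosed_iInter fun x => isClosed_iInter fun y =>
        isClosed_eq ?_ ?_
      · exact continuous_inner_apply continuous_id _ _
      · have h : ∀ T : H →WOT[ℂ] H, ⟪y, (R i).adjoint (B' (T x))⟫_ℂ
            = ⟪(toCLM B').adjoint (R i y), T x⟫_ℂ := by
          intro T
          rw [ContinuousLinearMap.adjoint_inner_left, ContinuousLinearMap.adjoint_inner_right]
          rfl
        simp_rw [h]
        exact continuous_inner_apply continuous_id _ _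
    have hRa : ∀ (X : H →L[ℂ] H) i m, (R i).adjoint (π X m) = X ((R i).adjoint m) := by
      intro X i m
      refine ext_inner_left ℂ fun y => ?_
      have h := congrArg (fun S => S y) (hR X.adjoint i)
      have hs : π X.adjoint = (π X).adjoint := map_star π X
      rw [hs] at h
      simp only [ContinuousLinearMap.comp_apply] at h
      rw [ContinuousLinearMap.adjoint_inner_right, ← ContinuousLinearMap.adjoint_inner_left, h,
        ← ContinuousLinearMap.adjoint_inner_right, ContinuousLinearMap.adjoint_inner_left]
    have hmem := (closure_minimal (fun T hT => ?_) hcl) (hdense (ofCLM X) hX)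
    · ext x
      rw [← sub_eq_zero]
      refine hR0 _ fun i => ?_
      rw [map_sub, sub_eq_zero]
      refine ext_inner_left ℂ fun y => ?_
      have := hmem i x y
      simpa [hRa] using this
    · obtain ⟨n, hn⟩ := hT
      intro i x y
      have := congrArg (fun S => ⟪y, (R i).adjoint (S x)⟫_ℂ) (hint n _ hn)
      simpa [hRa] using this
  · have hmem : ∀ n, V - B n ∈ 𝒯 := by
      intro n
      refine hB𝒯 n 𝒯 (isClosed_of_isClosed_wot h𝒯) fun U hU hUU => ?_
      rw [← NonUnitalStarSubalgebra.unitization_range] at hU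
      obtain ⟨x, hxU⟩ := hU
      set X : H →L[ℂ] H := (x.snd : H →L[ℂ] H) with hX
      have hXA : X ∈ 𝒜 := hle n x.snd.2
      have hXs : star X ∈ 𝒜 := star_mem hXA
      set c := x.fst
      have hU : U = c • 1 + X := by
        refine hxU.symm.trans ?_
        change NonUnitalStarSubalgebra.unitization (𝒜s n) x = _
        simp [Algebra.algebraMap_eq_smul_one, c, hX]
      rw [hU] at hUU ⊢
      -- With `U = c + X` and `U U† = 1`, one has `V - π(U) V U† = π(U) (π(U†) V - V U†)`; the
      -- scalar part of `U†` drops out of the bracket.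
      have h3 : V - π (c • 1 + X) ∘L V ∘L star (c • 1 + X)
          = c • (π (star X) ∘L V - V ∘L star X)
            + π X ∘L (π (star X) ∘L V - V ∘L star X) := by
        have h4 : π (c • 1 + X) ∘L (π (star (c • 1 + X)) ∘L V) = V := by
          rw [← ContinuousLinearMap.comp_assoc, ← ContinuousLinearMap.mul_def, ← map_mul, hUU,
            map_one]
          rfl
        calc V - π (c • 1 + X) ∘L V ∘L star (c • 1 + X)
            = π (c • 1 + X) ∘L (π (star (c • 1 + X)) ∘L V)
              - π (c • 1 + X) ∘L V ∘L star (c • 1 + X) := by rw [h4]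
          _ = _ := by
            ext x
            simp [smul_sub]
            abel
      rw [h3]
      exact 𝒯.add_mem (𝒯.smul_mem _ (h1 _ hXs)) (h2 _ hXA _ hXs)
    have hlim : Tendsto (fun n => ofCLM (V - B n)) F (𝓝 (ofCLM (V - toCLM B'))) := by
      rw [tendsto_iff_forall_inner_apply_tendsto]
      intro x y
      simpa [inner_sub_right] using (hB' x y).const_sub ⟪y, V x⟫_ℂ
    exact h𝒯.mem_of_tendsto hlim (Eventually.of_forall hmem)

end Averaging

end

section

open Filter Topology ContinuousLinearMapWOT

/-! ### Invariance and the normal form, for an abstract representation `π`. -/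

section Invariance

variable {H : Type*} [NormedAddCommGroup H] [InnerProductSpace ℂ H] [CompleteSpace H]
variable {M : Type*} [NormedAddCommGroup M] [InnerProductSpace ℂ M] [CompleteSpace M]
variable {𝒜 : NonUnitalStarSubalgebra ℂ (H →L[ℂ] H)}

/-- A weakly closed *-algebra has a unit. -/
theorem IsWeaklyClosed.exists_unit (hclosed : IsWeaklyClosed 𝒜) :
    ∃ P ∈ 𝒜, ∀ X ∈ 𝒜, P * X = X ∧ X * P = X := by
  -- Norm closedness makes `𝒜` a C*-algebra with an approximate unit; its weak limit along an
  -- ultrafilter is the unit.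
  have : IsClosed (𝒜 : Set (H →L[ℂ] H)) := isClosed_of_isClosed_wot hclosed
  let _ := CStarAlgebra.spectralOrder 𝒜
  have := CStarAlgebra.spectralOrderedRing 𝒜
  have hl := CStarAlgebra.increasingApproximateUnit 𝒜
  have := hl.neBot
  let F : Ultrafilter 𝒜 := Ultrafilter.of (CStarAlgebra.approximateUnit 𝒜)
  have hF : (F : Filter 𝒜) ≤ CStarAlgebra.approximateUnit 𝒜 := Ultrafilter.of_le _
  obtain ⟨P, hP⟩ := exists_tendsto_wot F (fun e => (e : H →L[ℂ] H)) 1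
    (hF hl.eventually_norm)
  refine ⟨toCLM P, hclosed.mem_of_tendsto hP (Eventually.of_forall fun e => e.2), ?_⟩
  rw [tendsto_iff_forall_inner_apply_tendsto] at hP
  have hinner : ∀ (f : 𝒜 → H →L[ℂ] H) (X : H →L[ℂ] H),
      Tendsto f (CStarAlgebra.approximateUnit 𝒜) (𝓝 X) →
      ∀ x y, Tendsto (fun e => ⟪y, f e x⟫_ℂ) F (𝓝 ⟪y, X x⟫_ℂ) := fun f X hf x y =>
    (((innerSL ℂ y).comp (ContinuousLinearMap.apply ℂ H x)).continuous.tendsto X).comp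
      (hf.mono_left hF)
  intro X hX
  have hr : Tendsto (fun e : 𝒜 => (e : H →L[ℂ] H) * X) (CStarAlgebra.approximateUnit 𝒜) (𝓝 X) :=
    (continuous_subtype_val.tendsto _).comp (hl.tendsto_mul_right ⟨X, hX⟩)
  have hl : Tendsto (fun e : 𝒜 => X * (e : H →L[ℂ] H)) (CStarAlgebra.approximateUnit 𝒜) (𝓝 X) :=
    (continuous_subtype_val.tendsto _).comp (hl.tendsto_mul_left ⟨X, hX⟩)
  constructor
  · ext x
    exact ext_inner_left ℂ fun y => tendsto_nhds_unique (hP (X x) y) (hinner _ _ hr x y)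
  · ext x
    refine ext_inner_left ℂ fun y => tendsto_nhds_unique ?_ (hinner _ _ hl x y)
    simpa [ContinuousLinearMap.adjoint_inner_left] using hP x (X.adjoint y)

theorem isSelfAdjoint_of_unit {P : H →L[ℂ] H} (hP : P ∈ 𝒜)
    (hu : ∀ X ∈ 𝒜, P * X = X ∧ X * P = X) : IsSelfAdjoint P := by
  have h := (hu _ (star_mem hP)).2
  have h2 := congrArg star h
  rw [star_mul, star_star] at h2
  exact h.symm.trans h2

theorem P₀_adjoint_apply (ψ : nullSpace 𝒜) : (P₀ 𝒜).adjoint ψ = (ψ : H) := by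
  simp [P₀, Submodule.adjoint_orthogonalProjectionOnto]

theorem comp_P₀_adjoint {X : H →L[ℂ] H} (hX : X ∈ 𝒜) : X ∘L (P₀ 𝒜).adjoint = 0 := by
  ext ψ
  simpa [P₀_adjoint_apply] using ψ.2 X hX

/-- Every `X ∈ 𝒜` kills `x - P x` because `X P = X`, and `P x` is orthogonal to the null space
because `P` is self-adjoint and vanishes there. -/
theorem P₀_adjoint_comp_P₀ {P : H →L[ℂ] H} (hP : P ∈ 𝒜)
    (hu : ∀ X ∈ 𝒜, P * X = X ∧ X * P = X) : (P₀ 𝒜).adjoint ∘L P₀ 𝒜 = 1 - P := by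
  ext x
  rw [ContinuousLinearMap.comp_apply, P₀_adjoint_apply]
  refine Submodule.eq_starProjection_of_mem_of_inner_eq_zero (u := x) (v := x - P x) ?_ ?_
  · intro X hX
    rw [map_sub, sub_eq_zero]
    exact (congrArg (fun S => S x) (hu X hX).2).symm
  · intro ψ hψ
    have h1 : P.adjoint = P := isSelfAdjoint_of_unit hP hu
    rw [sub_sub_cancel, ← h1, ContinuousLinearMap.adjoint_inner_left, hψ P hP, inner_zero_right]

/-- The operators `S` with `C S ∈ 𝒜`. -/
def leftQuotient (𝒜 : NonUnitalStarSubalgebra ℂ (H →L[ℂ] H)) (C : M →L[ℂ] H) :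
    Submodule ℂ (H →L[ℂ] M) where
  carrier := {S | C ∘L S ∈ 𝒜}
  zero_mem' := by simp [zero_mem]
  add_mem' := by
    intro a b ha hb
    simpa [ContinuousLinearMap.comp_add] using add_mem ha hb
  smul_mem' := by
    intro c a ha
    simpa [ContinuousLinearMap.comp_smul] using SMulMemClass.smul_mem c ha

/-- Left multiplication by `C` is weakly continuous, as `C` moves to the other side of the inner
product. These subspaces serve as `𝒯` in `exists_intertwiner`. -/
theorem IsWeaklyClosed.leftQuotient (hclosed : IsWeaklyClosed 𝒜) (C : M →L[ℂ] H) :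
    IsClosed {T : H →WOT[ℂ] M | toCLM T ∈ leftQuotient 𝒜 C} := by
  refine IsClosed.preimage (f := fun T : H →WOT[ℂ] M => ofCLM (C ∘L toCLM T)) ?_ hclosed
  rw [ContinuousLinearMapWOT.continuous_iff]
  intro x y
  have h : ∀ T : H →WOT[ℂ] M, ⟪y, C (T x)⟫_ℂ = ⟪C.adjoint y, T x⟫_ℂ := fun T => by
    rw [ContinuousLinearMap.adjoint_inner_left]
  exact (continuous_inner_apply continuous_id x (C.adjoint y)).congr fun T => (h T).symm

/-- If `G† X + X G ∈ 𝒜` for all `X` in an AFD algebra `𝒜`, then `G` is the sum of an element of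
`𝒜`, a skew-adjoint element of the commutant and an operator into the null space. -/
theorem exists_sum_of_invariant (hclosed : IsWeaklyClosed 𝒜) (hAFD : IsAFD 𝒜) (G : H →L[ℂ] H)
    (hG : ∀ X ∈ 𝒜, star G * X + X * G ∈ 𝒜) :
    ∃ (K₀ : H →L[ℂ] nullSpace 𝒜) (KA HA' : H →L[ℂ] H), KA ∈ 𝒜 ∧ HA' ∈ commutant 𝒜 ∧
      IsSelfAdjoint HA' ∧ G = KA + Complex.I • HA' + (P₀ 𝒜).adjoint ∘L K₀ := by
  obtain ⟨P, hP, hu⟩ := hclosed.exists_unit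
  have hPs : star P = P := isSelfAdjoint_of_unit hP hu
  -- Subtract the hypothesis at `X`, multiplied by `Y` on the right, from the hypothesis at `X Y`:
  -- the terms with `G†` cancel.
  have hder : ∀ X ∈ 𝒜, ∀ Y ∈ 𝒜, X * (Y * G - G * Y) ∈ 𝒜 := by
    intro X hX Y hY
    have h := sub_mem (hG _ (mul_mem hX hY)) (mul_mem (hG X hX) hY)
    convert h using 1
    noncomm_ring
  obtain ⟨E, hE, hE𝒯⟩ := exists_intertwiner hAFD (StarAlgHom.id ℂ (H →L[ℂ] H))
    (fun _ : Unit => ContinuousLinearMap.id ℂ H) (fun X _ => by ext; simp)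
    (fun m hm => by simpa [ContinuousLinearMap.adjoint_id] using hm ()) G
  have hPE : P * (G - E) ∈ 𝒜 := hE𝒯 (GKLS.leftQuotient 𝒜 P) (hclosed.leftQuotient P)
    (fun X hX => hder P hP X hX) (fun X hX Y hY => by
      have := hder (P * X) (mul_mem hP hX) Y hY
      rwa [mul_assoc] at this)
  have hE' : ∀ X ∈ 𝒜, X * E = E * X := hE
  set S := P * (G - E) with hS
  set Q := P * E with hQ
  have hQc : ∀ X ∈ 𝒜, Q * X = X * Q := by
    intro X hX
    rw [hQ, mul_assoc, ← hE' X hX, ← mul_assoc, ← mul_assoc, (hu X hX).1, (hu X hX).2]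
  have hQsc : ∀ X ∈ 𝒜, star Q * X = X * star Q := by
    intro X hX
    have := congrArg star (hQc _ (star_mem hX))
    simpa using this.symm
  have hPG : P * G = S + Q := by rw [hS, hQ]; noncomm_ring
  -- The hypothesis at `X = P` gives `G†P + PG ∈ 𝒜`, and `S` is already in `𝒜`.
  have hQQ : Q + star Q ∈ 𝒜 := by
    have h1 := hG P hP
    have h2 : star G * P = star S + star Q := by
      rw [← star_add, ← hPG, star_mul, hPs]
    rw [h2, hPG] at h1
    have h3 := sub_mem (sub_mem h1 hPE) (star_mem hPE)
    convert h3 using 1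
    abel
  -- Here `G = S + Q + (1 - P) G`: the Hermitian part of `Q` goes into `𝒜`, the skew part is `i`
  -- times a self-adjoint element of the commutant, and `1 - P` is the projection onto the null
  -- space.
  refine ⟨P₀ 𝒜 ∘L G, S + (1 / 2 : ℂ) • (Q + star Q),
    (-Complex.I / 2 : ℂ) • (Q - star Q), add_mem hPE (SMulMemClass.smul_mem _ hQQ), ?_, ?_, ?_⟩
  · intro X hX
    simp only [smul_mul_assoc, mul_smul_comm, sub_mul, mul_sub, hQc X hX, hQsc X hX]
  · rw [isSelfAdjoint_iff, star_smul, star_sub, star_star]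
    simp only [RCLike.star_def, map_div₀, map_neg, Complex.conj_I, map_ofNat]
    rw [← neg_sub Q, smul_neg, ← neg_smul]
    congr 1
    ring
  · rw [← ContinuousLinearMap.comp_assoc, P₀_adjoint_comp_P₀ hP hu, smul_smul]
    have h1 : (1 - P) ∘L G = G - (S + Q) := by rw [← hPG]; exact sub_mul 1 P G |>.trans (by simp)
    have h2 : Complex.I * (-Complex.I / 2) = 1 / 2 := by
      linear_combination (-1 / 2 : ℂ) * Complex.I_mul_I
    rw [h1, h2]
    module

theorem map_comp_adjoint (π : (H →L[ℂ] H) →⋆ₐ[ℂ] (M →L[ℂ] M)) {S : H →L[ℂ] M} {X : H →L[ℂ] H} :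
    (π X ∘L S).adjoint = S.adjoint ∘L π (star X) := by
  rw [ContinuousLinearMap.adjoint_comp, map_star, ContinuousLinearMap.star_eq_adjoint]

theorem map_comp_map (π : (H →L[ℂ] H) →⋆ₐ[ℂ] (M →L[ℂ] M)) (S : H →L[ℂ] M) (X Y : H →L[ℂ] H) :
    π X ∘L π Y ∘L S = π (X * Y) ∘L S := by
  rw [map_mul]; rfl

theorem adjoint_comp_of_intertwines (π : (H →L[ℂ] H) →⋆ₐ[ℂ] (M →L[ℂ] M)) {B : H →L[ℂ] M}
    (hB : ∀ X ∈ 𝒜, π X ∘L B = B ∘L X) {X : H →L[ℂ] H} (hX : X ∈ 𝒜) :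
    B.adjoint ∘L π X = X ∘L B.adjoint := by
  have h := congrArg ContinuousLinearMap.adjoint (hB _ (star_mem hX))
  rw [map_comp_adjoint, star_star, ContinuousLinearMap.adjoint_comp,
    ContinuousLinearMap.star_eq_adjoint, ContinuousLinearMap.adjoint_adjoint] at h
  exact h

/-- Up to a part that does not contribute, `L` is determined on `𝒜` by `A` and
`G = K - B† A - ½ B† B`. -/
theorem generator_eq (π : (H →L[ℂ] H) →⋆ₐ[ℂ] (M →L[ℂ] M)) {V A B W : H →L[ℂ] M}
    {K G : H →L[ℂ] H} (hB : ∀ X ∈ 𝒜, π X ∘L B = B ∘L X) (hW : ∀ X ∈ 𝒜, π X ∘L W = 0)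
    (hV : V = W + A + B)
    (hK : K = B.adjoint ∘L A + (1 / 2 : ℂ) • (B.adjoint ∘L B) + G)
    {X : H →L[ℂ] H} (hX : X ∈ 𝒜) :
    V.adjoint ∘L π X ∘L V - K.adjoint * X - X * K
      = A.adjoint ∘L π X ∘L A - (star G * X + X * G) := by
  have hWX : W.adjoint ∘L π X = 0 := by
    have h := congrArg ContinuousLinearMap.adjoint (hW _ (star_mem hX))
    rwa [map_comp_adjoint, star_star, map_zero] at h
  have hBX := adjoint_comp_of_intertwines π hB hX
  have e1 : ∀ x, π X (B x) = B (X x) := fun x => congrArg (fun S => S x) (hB X hX)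
  have e2 : ∀ x, π X (W x) = 0 := fun x => congrArg (fun S => S x) (hW X hX)
  have e3 : ∀ x, W.adjoint (π X x) = 0 := fun x => congrArg (fun S => S x) hWX
  have e4 : ∀ x, B.adjoint (π X x) = X (B.adjoint x) := fun x => congrArg (fun S => S x) hBX
  -- `W` and `B` need not be orthogonal, but `W† B X = W† π(X) B = 0`.
  have e5 : ∀ x, W.adjoint (B (X x)) = 0 := fun x => by rw [← e1, e3]
  have e6 : ∀ x, B.adjoint (B (X x)) = X (B.adjoint (B x)) := fun x => by rw [← e1, e4]
  have hKa : K.adjoint = A.adjoint ∘L B + (1 / 2 : ℂ) • (B.adjoint ∘L B) + star G := by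
    have hc : starRingEnd ℂ (1 / 2) = 1 / 2 := by rw [map_div₀, map_one, map_ofNat]
    rw [hK, map_add, map_add, map_smulₛₗ, hc, ContinuousLinearMap.star_eq_adjoint]
    simp only [ContinuousLinearMap.adjoint_comp, ContinuousLinearMap.adjoint_adjoint]
  rw [hKa]
  ext x
  simp only [hK, hV, map_add, _root_.add_apply, _root_.sub_apply,
    ContinuousLinearMap.comp_apply, mul_apply_eq_comp,
    _root_.smul_apply, map_smul, e1, e2, e3, e4, e5, e6, map_zero]
  module

/-- The normal form implies invariance. -/
theorem invariant_of_form (π : (H →L[ℂ] H) →⋆ₐ[ℂ] (M →L[ℂ] M)) {V A B W : H →L[ℂ] M}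
    {K KA HA' : H →L[ℂ] H} {K₀ : H →L[ℂ] nullSpace 𝒜}
    (hKA : KA ∈ 𝒜) (hHA : HA' ∈ commutant 𝒜) (hHs : IsSelfAdjoint HA')
    (hA : ∀ X ∈ 𝒜, A.adjoint ∘L π X ∘L A ∈ 𝒜)
    (hB : ∀ X ∈ 𝒜, π X ∘L B = B ∘L X) (hW : ∀ X ∈ 𝒜, π X ∘L W = 0)
    (hV : V = W + A + B)
    (hK : K = B.adjoint ∘L A + (1 / 2 : ℂ) • (B.adjoint ∘L B) + KA + Complex.I • HA'
      + (P₀ 𝒜).adjoint ∘L K₀) {X : H →L[ℂ] H} (hX : X ∈ 𝒜) :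
    V.adjoint ∘L π X ∘L V - K.adjoint * X - X * K ∈ 𝒜 := by
  rw [generator_eq π (G := KA + Complex.I • HA' + (P₀ 𝒜).adjoint ∘L K₀) hB hW hV
    (by rw [hK]; abel) hX]
  have h1 : ∀ Y ∈ 𝒜, Y * ((P₀ 𝒜).adjoint ∘L K₀) = 0 := fun Y hY => by
    rw [ContinuousLinearMap.mul_def, ← ContinuousLinearMap.comp_assoc, comp_P₀_adjoint hY,
      ContinuousLinearMap.zero_comp]
  have h2 : star ((P₀ 𝒜).adjoint ∘L K₀) * X = 0 := by
    have h := congrArg star (h1 _ (star_mem hX))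
    rwa [star_mul, star_star, star_zero] at h
  have h3 : star (KA + Complex.I • HA' + (P₀ 𝒜).adjoint ∘L K₀) * X
      + X * (KA + Complex.I • HA' + (P₀ 𝒜).adjoint ∘L K₀) = star KA * X + X * KA := by
    rw [star_add, star_add, add_mul, add_mul, mul_add, mul_add, h2, h1 X hX, star_smul,
      hHs.star_eq, smul_mul_assoc, mul_smul_comm, hHA X hX, RCLike.star_def, Complex.conj_I]
    module
  rw [h3]
  exact sub_mem (hA X hX) (add_mem (mul_mem (star_mem hKA) hX) (mul_mem hX hKA))

/-- Invariance implies the normal form. -/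
theorem exists_form_of_invariant (hclosed : IsWeaklyClosed 𝒜) (hAFD : IsAFD 𝒜)
    (π : (H →L[ℂ] H) →⋆ₐ[ℂ] (M →L[ℂ] M)) {ι : Type*} (R : ι → H →L[ℂ] M)
    (hR : ∀ X i, π X ∘L R i = R i ∘L X)
    (hR0 : ∀ m, (∀ i, (R i).adjoint m = 0) → m = 0) (V : H →L[ℂ] M) (K : H →L[ℂ] H)
    (hinv : ∀ X ∈ 𝒜, V.adjoint ∘L π X ∘L V - K.adjoint * X - X * K ∈ 𝒜) :
    ∃ (A B : H →L[ℂ] M) (K₀ : H →L[ℂ] nullSpace 𝒜) (KA HA' : H →L[ℂ] H),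
      KA ∈ 𝒜 ∧ HA' ∈ commutant 𝒜 ∧ IsSelfAdjoint HA' ∧
      (∀ X ∈ 𝒜, A.adjoint ∘L π X ∘L A ∈ 𝒜) ∧ (∀ X ∈ 𝒜, π X ∘L B = B ∘L X) ∧
      V = π ((P₀ 𝒜).adjoint ∘L P₀ 𝒜) ∘L V + A + B ∧
      K = B.adjoint ∘L A + (1 / 2 : ℂ) • (B.adjoint ∘L B) + KA + Complex.I • HA'
        + (P₀ 𝒜).adjoint ∘L K₀ := by
  obtain ⟨P, hP, hu⟩ := hclosed.exists_unit
  have hPs : star P = P := isSelfAdjoint_of_unit hP hu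
  obtain ⟨B, hB, hB𝒯⟩ := exists_intertwiner hAFD π R hR hR0 V
  set D : (H →L[ℂ] H) → H →L[ℂ] M := fun X => π X ∘L V - V ∘L X with hD
  -- The product is `L(Y†XZ) - L(Y†X)Z - Y†L(XZ) + Y†L(X)Z`.
  have hDD : ∀ X ∈ 𝒜, ∀ Y ∈ 𝒜, ∀ Z ∈ 𝒜, ((D Y).adjoint ∘L π X) ∘L D Z ∈ 𝒜 := by
    intro X hX Y hY Z hZ
    have hY' := star_mem hY
    have h := add_mem (sub_mem (sub_mem (hinv _ (mul_mem (mul_mem hY' hX) hZ))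
      (mul_mem (hinv _ (mul_mem hY' hX)) hZ)) (mul_mem hY' (hinv _ (mul_mem hX hZ))))
      (mul_mem (mul_mem hY' (hinv X hX)) hZ)
    convert h using 1
    have hπY : (π Y).adjoint = π (star Y) := (map_star π Y).symm
    simp only [hD, map_sub, ContinuousLinearMap.adjoint_comp, hπY,
      ← ContinuousLinearMap.star_eq_adjoint Y]
    ext x
    simp only [map_mul, _root_.add_apply, _root_.sub_apply,
      ContinuousLinearMap.comp_apply, mul_apply_eq_comp, map_sub]
    abel
  have hDA : ∀ X ∈ 𝒜, ∀ Y ∈ 𝒜, ((D Y).adjoint ∘L π X) ∘L (V - B) ∈ 𝒜 := by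
    intro X hX Y hY
    refine hB𝒯 (leftQuotient 𝒜 _) (hclosed.leftQuotient _) (fun Z hZ => hDD X hX Y hY Z hZ)
      (fun W hW Z hZ => ?_)
    have h := hDD (X * W) (mul_mem hX hW) Y hY Z hZ
    rw [map_mul] at h
    exact h
  -- Taking adjoints moves the remaining `D` to the right, where the averaging lemma applies again.
  have hAD : ∀ X ∈ 𝒜, ∀ Y ∈ 𝒜, ((V - B).adjoint ∘L π X) ∘L D Y ∈ 𝒜 := by
    intro X hX Y hY
    have h := star_mem (hDA _ (star_mem hX) Y hY)
    rwa [ContinuousLinearMap.star_eq_adjoint, ContinuousLinearMap.adjoint_comp,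
      ← map_comp_adjoint, ContinuousLinearMap.adjoint_adjoint,
      ← ContinuousLinearMap.comp_assoc] at h
  have hAA : ∀ X ∈ 𝒜, ((V - B).adjoint ∘L π X) ∘L (V - B) ∈ 𝒜 := by
    intro X hX
    refine hB𝒯 (leftQuotient 𝒜 _) (hclosed.leftQuotient _) (fun Z hZ => hAD X hX Z hZ)
      (fun W hW Z hZ => ?_)
    have h := hAD (X * W) (mul_mem hX hW) Z hZ
    rw [map_mul] at h
    exact h
  -- Multiplying by `π P` changes neither property and leaves `π(1 - P) V`, which factors through
  -- the null space.
  set A' := π P ∘L (V - B) with hA'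
  set B' := π P ∘L B with hB'
  have hA'm : ∀ X ∈ 𝒜, A'.adjoint ∘L π X ∘L A' ∈ 𝒜 := by
    intro X hX
    have h : A'.adjoint ∘L π X ∘L A' = ((V - B).adjoint ∘L π X) ∘L (V - B) := by
      rw [hA', map_comp_adjoint, hPs, map_comp_map, (hu X hX).2, ContinuousLinearMap.comp_assoc,
        map_comp_map, (hu X hX).1]
      rfl
    rw [h]
    exact hAA X hX
  have hB'm : ∀ X ∈ 𝒜, π X ∘L B' = B' ∘L X := by
    intro X hX
    rw [hB', map_comp_map, (hu X hX).2, ContinuousLinearMap.comp_assoc, ← hB X hX, map_comp_map,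
      (hu X hX).1]
  have hV : V = π ((P₀ 𝒜).adjoint ∘L P₀ 𝒜) ∘L V + A' + B' := by
    rw [P₀_adjoint_comp_P₀ hP hu, hA', hB', map_sub, map_one]
    ext x
    simp
  have hW : ∀ X ∈ 𝒜, π X ∘L π ((P₀ 𝒜).adjoint ∘L P₀ 𝒜) ∘L V = 0 := by
    intro X hX
    rw [map_comp_map, P₀_adjoint_comp_P₀ hP hu, mul_sub, mul_one, (hu X hX).2, sub_self, map_zero,
      ContinuousLinearMap.zero_comp]
  set G := K - (B'.adjoint ∘L A' + (1 / 2 : ℂ) • (B'.adjoint ∘L B')) with hG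
  have hGm : ∀ X ∈ 𝒜, star G * X + X * G ∈ 𝒜 := by
    intro X hX
    have h := sub_mem (hA'm X hX) (hinv X hX)
    rwa [generator_eq π hB'm hW hV (add_sub_cancel _ K).symm hX, sub_sub_cancel] at h
  obtain ⟨K₀, KA, HA', h1, h2, h3, h4⟩ := exists_sum_of_invariant hclosed hAFD G hGm
  refine ⟨A', B', K₀, KA, HA', h1, h2, h3, hA'm, hB'm, hV, ?_⟩
  have h5 : K = B'.adjoint ∘L A' + (1 / 2 : ℂ) • (B'.adjoint ∘L B') + G :=
    (add_sub_cancel _ K).symm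
  rw [h5, h4]
  abel

end Invariance

end

/-! ### Operators on `H ⊗ E` through their slices. -/

section Tensor

variable {H : Type u} [NormedAddCommGroup H] [InnerProductSpace ℂ H]
variable {H₁ : Type u} [NormedAddCommGroup H₁] [InnerProductSpace ℂ H₁]
variable {H₂ : Type u} [NormedAddCommGroup H₂] [InnerProductSpace ℂ H₂]
variable {E : Type v} [NormedAddCommGroup E] [InnerProductSpace ℂ E]
variable {M : Type*} [NormedAddCommGroup M] [InnerProductSpace ℂ M]

theorem ext_tmul {S T : HTensor H E →L[ℂ] M}
    (h : ∀ x e, S ((x ⊗ₜ[ℂ] e : H ⊗[ℂ] E) : HTensor H E)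
      = T ((x ⊗ₜ[ℂ] e : H ⊗[ℂ] E) : HTensor H E)) : S = T := by
  ext ξ
  induction ξ using UniformSpace.Completion.induction_on with
  | hp => exact isClosed_eq S.continuous T.continuous
  | ih a =>
    induction a using TensorProduct.induction_on with
    | zero => rw [UniformSpace.Completion.coe_zero, map_zero, map_zero]
    | tmul x e => exact h x e
    | add a b ha hb => rw [UniformSpace.Completion.coe_add, map_add, map_add, ha, hb]

/-- The map `x ↦ x ⊗ e`. -/
def slice (H : Type u) [NormedAddCommGroup H] [InnerProductSpace ℂ H] (e : E) :
    H →L[ℂ] HTensor H E :=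
  UniformSpace.Completion.toComplL ∘L (TensorProduct.mkL ℂ H E).flip e

theorem slice_apply (e : E) (x : H) :
    slice H e x = ((x ⊗ₜ[ℂ] e : H ⊗[ℂ] E) : HTensor H E) := rfl

theorem inner_slice_slice (e f : E) (x y : H) :
    ⟪slice H e x, slice H f y⟫_ℂ = ⟪x, y⟫_ℂ * ⟪e, f⟫_ℂ := by
  rw [slice_apply, slice_apply, UniformSpace.Completion.inner_coe, TensorProduct.inner_tmul]

theorem continuous_slice (x : H) : Continuous fun e : E => slice H e x :=
  (UniformSpace.Completion.toComplL ∘L TensorProduct.mkL ℂ H E x).continuous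

theorem eq_zero_of_inner_slice {ξ : HTensor H E} (h : ∀ e x, ⟪ξ, slice H e x⟫_ℂ = 0) : ξ = 0 := by
  have h1 : innerSL ℂ ξ = 0 := ext_tmul fun x e => by
    simpa [slice_apply] using h e x
  have h2 := congrArg (fun S => S ξ) h1
  simpa using h2

theorem ampl_comp_slice (S : H₁ →L[ℂ] H₂) (e : E) :
    ampl E S ∘L slice H₁ e = slice H₂ e ∘L S := by
  ext x
  exact ampl_tmul E S x e

theorem ampl_comp (S : H₁ →L[ℂ] H₂) (T : H →L[ℂ] H₁) : ampl E (S ∘L T) = ampl E S ∘L ampl E T :=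
  ext_tmul fun x e => by simp [ampl_tmul]

variable [CompleteSpace H] [CompleteSpace H₁] [CompleteSpace H₂]

theorem adjoint_ampl (S : H₁ →L[ℂ] H₂) : (ampl E S).adjoint = ampl E S.adjoint := by
  refine ext_tmul fun x e => ?_
  rw [← sub_eq_zero]
  refine eq_zero_of_inner_slice fun f y => ?_
  rw [inner_sub_left, sub_eq_zero, ContinuousLinearMap.adjoint_inner_left, slice_apply, ampl_tmul,
    ampl_tmul, ← slice_apply, ← slice_apply, ← slice_apply, ← slice_apply, inner_slice_slice,
    inner_slice_slice, ContinuousLinearMap.adjoint_inner_left]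

/-- Taking the component along `e` turns `S ⊗ 𝟙` into `S`; this translates the Stinespring
conditions into Kraus conditions. -/
theorem adjoint_slice_comp_ampl (S : H₁ →L[ℂ] H₂) (e : E) :
    (slice H₂ e).adjoint ∘L ampl E S = S ∘L (slice H₁ e).adjoint := by
  have h := congrArg ContinuousLinearMap.adjoint (ampl_comp_slice S.adjoint e)
  rwa [ContinuousLinearMap.adjoint_comp, ContinuousLinearMap.adjoint_comp, adjoint_ampl,
    ContinuousLinearMap.adjoint_adjoint] at h

theorem eq_zero_of_adjoint_slice {ξ : HTensor H E} (h : ∀ e, (slice H e).adjoint ξ = 0) : ξ = 0 :=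
  eq_zero_of_inner_slice fun e x => by
    rw [← ContinuousLinearMap.adjoint_inner_left, h, inner_zero_left]

/-- The representation `X ↦ X ⊗ 𝟙_E`. -/
def amplHom (H : Type u) [NormedAddCommGroup H] [InnerProductSpace ℂ H] [CompleteSpace H]
    (E : Type v) [NormedAddCommGroup E] [InnerProductSpace ℂ E] :
    (H →L[ℂ] H) →⋆ₐ[ℂ] (HTensor H E →L[ℂ] HTensor H E) where
  toFun := ampl E
  map_one' := ext_tmul fun x e => by simp [ampl_tmul]
  map_mul' S T := ampl_comp S T
  map_zero' := ext_tmul fun x e => by simp [ampl_tmul]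
  map_add' S T := ext_tmul fun x e => by
    simp [ampl_tmul, TensorProduct.add_tmul, UniformSpace.Completion.coe_add]
  commutes' c := ext_tmul fun x e => by
    simp [ampl_tmul, Algebra.algebraMap_eq_smul_one, ← TensorProduct.smul_tmul',
      UniformSpace.Completion.coe_smul]
  map_star' S := (adjoint_ampl S).symm

theorem amplHom_apply (X : H →L[ℂ] H) : amplHom H E X = ampl E X := rfl

/-! ### Components along a Hilbert basis of `E`; Stinespring versus Kraus. -/

section Basis

variable {N : Type w} (b : HilbertBasis N ℂ E)

/-- `x ↦ x ⊗ bₙ` as an isometry. -/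
def sliceIsometry (H : Type u) [NormedAddCommGroup H] [InnerProductSpace ℂ H]
    (b : HilbertBasis N ℂ E) (n : N) : H →ₗᵢ[ℂ] HTensor H E where
  toLinearMap := (slice H (b n)).toLinearMap
  norm_map' x := by
    have h : ‖b n‖ = 1 := b.orthonormal.1 n
    change ‖slice H (b n) x‖ = ‖x‖
    rw [slice_apply, UniformSpace.Completion.norm_coe, TensorProduct.norm_tmul, h, mul_one]

/-- For totality, a vector orthogonal to all `x ⊗ bₙ` is orthogonal to `x ⊗ e` for `e` in the closed
span of the basis, that is, for every `e`. -/
theorem isHilbertSum_slice : IsHilbertSum ℂ (fun _ : N => H) (sliceIsometry H b) := by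
  refine IsHilbertSum.mk (fun i j hij x y => ?_) ?_
  · have h : ⟪b i, b j⟫_ℂ = 0 := b.orthonormal.2 hij
    change ⟪slice H (b i) x, slice H (b j) y⟫_ℂ = 0
    rw [inner_slice_slice, h, mul_zero]
  · rw [top_le_iff, Submodule.topologicalClosure_eq_top_iff, Submodule.eq_bot_iff]
    intro ξ hξ
    refine eq_zero_of_inner_slice fun e x => ?_
    have hcl : IsClosed {e : E | ⟪ξ, slice H e x⟫_ℂ = 0} :=
      isClosed_eq (continuous_const.inner (continuous_slice x)) continuous_const
    have hmem : ∀ e ∈ Submodule.span ℂ (Set.range b), ⟪ξ, slice H e x⟫_ℂ = 0 := by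
      intro e he
      induction he using Submodule.span_induction with
      | mem e he =>
        obtain ⟨n, rfl⟩ := he
        exact (Submodule.mem_orthogonal' _ _).1 hξ _
          (Submodule.mem_iSup_of_mem n ⟨x, rfl⟩)
      | zero => simp [slice]
      | add e f _ _ he hf => simpa [slice, inner_add_right, he, hf] using congrArg₂ (· + ·) he hf
      | smul c e _ he => simpa [slice, inner_smul_right] using Or.inr he
    have h := closure_minimal (s := (Submodule.span ℂ (Set.range b) : Set E)) hmem hcl
    rw [← Submodule.topologicalClosure_coe, b.dense_span] at h
    exact h trivial

theorem adjoint_slice_slice (m : N) (x : N → H) {ξ : HTensor H E}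
    (h : HasSum (fun n => slice H (b n) (x n)) ξ) : (slice H (b m)).adjoint ξ = x m := by
  have h1 := h.mapL (slice H (b m)).adjoint
  have h2 : ∀ n, n ≠ m → (slice H (b m)).adjoint (slice H (b n) (x n)) = 0 := by
    intro n hn
    refine ext_inner_left ℂ fun y => ?_
    have h : ⟪b m, b n⟫_ℂ = 0 := b.orthonormal.2 hn.symm
    rw [ContinuousLinearMap.adjoint_inner_right, inner_slice_slice, h, mul_zero, inner_zero_right]
  have h3 : (slice H (b m)).adjoint (slice H (b m) (x m)) = x m := by
    refine ext_inner_left ℂ fun y => ?_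
    have h : ⟪b m, b m⟫_ℂ = 1 := inner_self_eq_one_of_norm_eq_one (b.orthonormal.1 m)
    rw [ContinuousLinearMap.adjoint_inner_right, inner_slice_slice, h, mul_one]
  have h4 := hasSum_single m h2
  rw [h3] at h4
  exact h1.unique h4

theorem hasSum_slice (ξ : HTensor H E) :
    HasSum (fun n => slice H (b n) ((slice H (b n)).adjoint ξ)) ξ := by
  have h := (isHilbertSum_slice (H := H) b).hasSum_linearIsometryEquiv_symm
    ((isHilbertSum_slice (H := H) b).linearIsometryEquiv ξ)
  rw [LinearIsometryEquiv.symm_apply_apply] at h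
  have h' : HasSum (fun n => slice H (b n)
    ((isHilbertSum_slice (H := H) b).linearIsometryEquiv ξ n)) ξ := h
  convert h' using 3 with n
  exact adjoint_slice_slice b n _ h'

theorem eq_of_adjoint_slice {A B : M →L[ℂ] HTensor H₁ E}
    (h : ∀ n, (slice H₁ (b n)).adjoint ∘L A = (slice H₁ (b n)).adjoint ∘L B) : A = B := by
  ext x
  have hA := hasSum_slice b (A x)
  have h' : ∀ n, (slice H₁ (b n)).adjoint (A x) = (slice H₁ (b n)).adjoint (B x) :=
    fun n => congrArg (fun S => S x) (h n)
  simp only [h'] at hA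
  exact hA.unique (hasSum_slice b (B x))

/-- The expansion of `B† (X ⊗ 𝟙) A` in components. -/
theorem hasSumSOT_slice (A B : H →L[ℂ] HTensor H₁ E) (X : H₁ →L[ℂ] H₁) :
    HasSumSOT (fun n => ((slice H₁ (b n)).adjoint ∘L B).adjoint ∘L X ∘L
      ((slice H₁ (b n)).adjoint ∘L A)) (B.adjoint ∘L ampl E X ∘L A) := by
  intro ψ
  have h := (hasSum_slice b (ampl E X (A ψ))).mapL B.adjoint
  change HasSum _ (B.adjoint (ampl E X (A ψ)))
  convert h using 2 with n
  have h1 : (slice H₁ (b n)).adjoint (ampl E X (A ψ)) = X ((slice H₁ (b n)).adjoint (A ψ)) :=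
    congrArg (fun S => S (A ψ)) (adjoint_slice_comp_ampl X (b n))
  rw [h1]
  simp [ContinuousLinearMap.adjoint_comp]

theorem hasSumSOT_slice_one (A B : H →L[ℂ] HTensor H₁ E) :
    HasSumSOT (fun n => ((slice H₁ (b n)).adjoint ∘L B).adjoint ∘L
      ((slice H₁ (b n)).adjoint ∘L A)) (B.adjoint ∘L A) := by
  have h := hasSumSOT_slice b A B (ContinuousLinearMap.id ℂ H₁)
  have h1 : ampl E (ContinuousLinearMap.id ℂ H₁) = ContinuousLinearMap.id ℂ _ :=
    map_one (amplHom H₁ E)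
  rwa [h1] at h

/-- A family `(aₙ)` with `∑ aₙ† aₙ` convergent is the family of components of an operator into
`H ⊗ E`. -/
theorem exists_of_hasSumSOT {a : N → H →L[ℂ] H} {S : H →L[ℂ] H}
    (ha : HasSumSOT (fun n => (a n).adjoint ∘L a n) S) :
    ∃ A : H →L[ℂ] HTensor H E, ∀ n, (slice H (b n)).adjoint ∘L A = a n := by
  -- Pairing the series with `ψ` shows that `ψ ↦ (aₙ ψ)` maps into `ℓ²(N; H) ≅ H ⊗ E` with norm at
  -- most `√‖S‖`.
  have hsum : ∀ ψ, HasSum (fun n => ‖a n ψ‖ ^ 2) (RCLike.re ⟪ψ, S ψ⟫_ℂ) := by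
    intro ψ
    have h := ((ha ψ).mapL (innerSL ℂ ψ)).mapL Complex.reCLM
    change HasSum _ (Complex.reCLM (innerSL ℂ ψ (S ψ)))
    convert h using 2 with n
    · simp [ContinuousLinearMap.adjoint_inner_right, ← Complex.ofReal_pow]
  have hmem : ∀ ψ, Memℓp (fun n => a n ψ) 2 := fun ψ =>
    memℓp_gen (by simpa using (hsum ψ).summable)
  let W := (isHilbertSum_slice (H := H) b).linearIsometryEquiv
  let f : H →ₗ[ℂ] lp (fun _ : N => H) 2 :=
    { toFun := fun ψ => ⟨fun n => a n ψ, hmem ψ⟩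
      map_add' := fun x y => by ext n; exact map_add (a n) x y
      map_smul' := fun c x => by ext n; exact map_smul (a n) c x }
  have hf : ∀ ψ, ‖f ψ‖ ≤ Real.sqrt ‖S‖ * ‖ψ‖ := by
    intro ψ
    have h1 : ‖f ψ‖ ^ 2 = RCLike.re ⟪ψ, S ψ⟫_ℂ := by
      have h := lp.hasSum_norm (p := 2) (by norm_num) (f ψ)
      have h2 : HasSum (fun n => ‖a n ψ‖ ^ 2) (‖f ψ‖ ^ 2) := by simpa [f] using h
      exact h2.unique (hsum ψ)
    have h2 : ‖f ψ‖ ^ 2 ≤ (Real.sqrt ‖S‖ * ‖ψ‖) ^ 2 := by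
      rw [h1, mul_pow, Real.sq_sqrt (norm_nonneg _)]
      calc RCLike.re ⟪ψ, S ψ⟫_ℂ ≤ ‖ψ‖ * ‖S ψ‖ := re_inner_le_norm _ _
        _ ≤ ‖ψ‖ * (‖S‖ * ‖ψ‖) := by gcongr; exact S.le_opNorm ψ
        _ = ‖S‖ * ‖ψ‖ ^ 2 := by ring
    exact (pow_le_pow_iff_left₀ (norm_nonneg _) (by positivity) two_ne_zero).1 h2
  refine ⟨W.symm.toContinuousLinearEquiv.toContinuousLinearMap ∘L f.mkContinuous _ hf, fun n => ?_⟩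
  ext ψ
  exact adjoint_slice_slice b n (fun n => a n ψ)
    ((isHilbertSum_slice (H := H) b).hasSum_linearIsometryEquiv_symm (f ψ))

/-- The components of a Stinespring representation form a Kraus representation. -/
theorem IsStinespring.isKraus {Φ : (H →L[ℂ] H) →ₗ[ℂ] (H →L[ℂ] H)} {V : H →L[ℂ] HTensor H E}
    (hV : IsStinespring Φ V) : IsKraus Φ fun n => (slice H (b n)).adjoint ∘L V := fun X => by
  rw [hV X]
  exact hasSumSOT_slice b V V X

/-- A Kraus representation consists of the components of a Stinespring representation. -/
theorem IsKraus.exists_isStinespring {Φ : (H →L[ℂ] H) →ₗ[ℂ] (H →L[ℂ] H)} {φ : N → H →L[ℂ] H}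
    (hφ : IsKraus Φ φ) : ∃ V : H →L[ℂ] HTensor H E, IsStinespring Φ V ∧
      ∀ n, (slice H (b n)).adjoint ∘L V = φ n := by
  obtain ⟨V, hV⟩ := exists_of_hasSumSOT b (hφ (ContinuousLinearMap.id ℂ H))
  refine ⟨V, fun X => ?_, hV⟩
  ext ψ
  have h := hasSumSOT_slice b V V X ψ
  simp only [hV] at h
  exact (hφ X ψ).unique h

/-- The components of a Stinespring normal form satisfy the Kraus normal form. -/
theorem StinespringForm.krausForm {𝒜 : NonUnitalStarSubalgebra ℂ (H →L[ℂ] H)}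
    {V : H →L[ℂ] HTensor H E} {K : H →L[ℂ] H} (h : StinespringForm 𝒜 V K) :
    KrausForm 𝒜 (fun n => (slice H (b n)).adjoint ∘L V) K := by
  obtain ⟨V₀, A, B, K₀, KA, HA', hKA, hHA, hHs, hA, hB, hV, hK⟩ := h
  refine ⟨fun n => (slice (nullSpace 𝒜) (b n)).adjoint ∘L V₀,
    fun n => (slice H (b n)).adjoint ∘L A, fun n => (slice H (b n)).adjoint ∘L B, K₀, KA, HA',
    B.adjoint ∘L A, B.adjoint ∘L B, ⟨_, hasSumSOT_slice_one b V₀ V₀⟩,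
    ⟨_, hasSumSOT_slice_one b A A⟩, hasSumSOT_slice_one b B B, hasSumSOT_slice_one b A B,
    hKA, hHA, hHs, fun X hX => ⟨_, hA X hX, hasSumSOT_slice b A A X⟩, fun n X hX => ?_,
    fun n => ?_, hK⟩
  · rw [ContinuousLinearMap.mul_def, ContinuousLinearMap.comp_assoc, ← hB X hX,
      ← ContinuousLinearMap.comp_assoc, adjoint_slice_comp_ampl]
    rfl
  · conv_lhs => rw [hV]
    beta_reduce
    rw [ContinuousLinearMap.comp_add, ContinuousLinearMap.comp_add,
      ← ContinuousLinearMap.comp_assoc, adjoint_slice_comp_ampl, ContinuousLinearMap.comp_assoc]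

end Basis

end Tensor

/-! ### The implications between invariance and the two normal forms. -/

section Main

variable {H : Type u} [NormedAddCommGroup H] [InnerProductSpace ℂ H] [CompleteSpace H]
variable {E : Type v} [NormedAddCommGroup E] [InnerProductSpace ℂ E]
variable {𝒜 : NonUnitalStarSubalgebra ℂ (H →L[ℂ] H)}
variable {Φ L : (H →L[ℂ] H) →ₗ[ℂ] (H →L[ℂ] H)} {K : H →L[ℂ] H}

theorem stinespringForm_of_invariant (hL : ∀ X : H →L[ℂ] H, L X = Φ X - K.adjoint * X - X * K)
    (hclosed : IsWeaklyClosed 𝒜) (hAFD : IsAFD 𝒜) (hinv : ∀ X ∈ 𝒜, L X ∈ 𝒜)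
    {V : H →L[ℂ] HTensor H E} (hV : IsStinespring Φ V) : StinespringForm 𝒜 V K := by
  obtain ⟨A, B, K₀, KA, HA', hKA, hHA, hHs, hA, hB, hV', hK⟩ :=
    exists_form_of_invariant hclosed hAFD (amplHom H E) (slice H (E := E))
      (fun X e => ampl_comp_slice X e) (fun _ => eq_zero_of_adjoint_slice) V K
      (fun X hX => by
        have h := hinv X hX
        rwa [hL, hV X] at h)
  -- `V₀ = (P₀ ⊗ 𝟙) V`, because `π(P₀† P₀)` factors as `(P₀† ⊗ 𝟙)(P₀ ⊗ 𝟙)`.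
  refine ⟨ampl E (P₀ 𝒜) ∘L V, A, B, K₀, KA, HA', hKA, hHA, hHs, hA, hB, ?_, hK⟩
  rw [← ContinuousLinearMap.comp_assoc, ← ampl_comp]
  exact hV'

theorem invariant_of_stinespringForm
    (hL : ∀ X : H →L[ℂ] H, L X = Φ X - K.adjoint * X - X * K)
    {V : H →L[ℂ] HTensor H E} (hV : IsStinespring Φ V) (h : StinespringForm 𝒜 V K) :
    ∀ X ∈ 𝒜, L X ∈ 𝒜 := by
  obtain ⟨V₀, A, B, K₀, KA, HA', hKA, hHA, hHs, hA, hB, hV', hK⟩ := h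
  intro X hX
  rw [hL, hV X]
  refine invariant_of_form (amplHom H E) hKA hHA hHs hA hB (fun Y hY => ?_) hV' hK hX
  rw [amplHom_apply, ← ContinuousLinearMap.comp_assoc, ← ampl_comp, comp_P₀_adjoint hY]
  have h0 : ampl E (0 : nullSpace 𝒜 →L[ℂ] H) = 0 := ext_tmul fun x e => by simp [ampl_tmul]
  rw [h0, ContinuousLinearMap.zero_comp]

/-- The Kraus normal form implies invariance. -/
theorem invariant_of_krausForm (hL : ∀ X : H →L[ℂ] H, L X = Φ X - K.adjoint * X - X * K)
    {N : Type w} {φ : N → H →L[ℂ] H} (hφ : IsKraus Φ φ) (h : KrausForm 𝒜 φ K) :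
    ∀ X ∈ 𝒜, L X ∈ 𝒜 := by
  let b : HilbertBasis N ℂ (lp (fun _ : N => ℂ) 2) :=
    HilbertBasis.ofRepr (LinearIsometryEquiv.refl ℂ _)
  obtain ⟨v, a, c, K₀, KA, HA', Sca, Scc, -, ⟨Saa, haa⟩, hcc, hca, hKA, hHA, hHs, ha, hc, hφ', hK⟩
    := h
  obtain ⟨V, hV, hVφ⟩ := hφ.exists_isStinespring b
  obtain ⟨A, hA⟩ := exists_of_hasSumSOT b haa
  obtain ⟨B, hB⟩ := exists_of_hasSumSOT b hcc
  have hSca : Sca = B.adjoint ∘L A := by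
    ext ψ
    have h := hasSumSOT_slice_one b A B ψ
    simp only [hA, hB] at h
    exact (hca ψ).unique h
  have hScc : Scc = B.adjoint ∘L B := by
    ext ψ
    have h := hasSumSOT_slice_one b B B ψ
    simp only [hB] at h
    exact (hcc ψ).unique h
  intro X hX
  rw [hL, hV X]
  -- There is no need to assemble the `vₙ`: only `π(Y) W = 0` matters, and the components `P₀† vₙ`
  -- of `W = V - A - B` show it.
  refine invariant_of_form (amplHom H (lp (fun _ : N => ℂ) 2)) (A := A) (B := B)
    (W := V - A - B) hKA hHA hHs
    (fun Y hY => ?_) (fun Y hY => ?_) (fun Y hY => ?_) (by abel) (by rw [hK, hSca, hScc]) hX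
  · obtain ⟨Z, hZ, hsum⟩ := ha Y hY
    have hYZ : A.adjoint ∘L ampl _ Y ∘L A = Z := by
      ext ψ
      have h := hasSumSOT_slice b A A Y ψ
      simp only [hA] at h
      exact h.unique (hsum ψ)
    rw [amplHom_apply, hYZ]
    exact hZ
  · refine eq_of_adjoint_slice b fun n => ?_
    rw [amplHom_apply, ← ContinuousLinearMap.comp_assoc, adjoint_slice_comp_ampl,
      ContinuousLinearMap.comp_assoc, hB, ← ContinuousLinearMap.comp_assoc, hB]
    exact (hc n Y hY).symm
  · refine eq_of_adjoint_slice b fun n => ?_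
    have h : (slice H (b n)).adjoint ∘L (V - A - B) = (P₀ 𝒜).adjoint ∘L v n := by
      rw [ContinuousLinearMap.comp_sub, ContinuousLinearMap.comp_sub, hVφ, hA, hB, hφ']
      abel
    rw [amplHom_apply, ← ContinuousLinearMap.comp_assoc, adjoint_slice_comp_ampl,
      ContinuousLinearMap.comp_assoc, h, ← ContinuousLinearMap.comp_assoc, comp_P₀_adjoint hY,
      ContinuousLinearMap.zero_comp, ContinuousLinearMap.comp_zero]

/-- Orthonormal vectors are `√2` apart, so balls of radius `1/2` around them are disjoint. -/
theorem countable_of_orthonormal [TopologicalSpace.SeparableSpace E] {s : Set E}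
    (hs : Orthonormal ℂ ((↑) : s → E)) : s.Countable := by
  refine Set.PairwiseDisjoint.countable_of_isOpen (s := fun x => Metric.ball x (1 / 2))
    (fun x hx y hy hxy => ?_) (fun _ _ => Metric.isOpen_ball)
    (fun x _ => ⟨x, Metric.mem_ball_self (by norm_num)⟩)
  refine Metric.ball_disjoint_ball ?_
  have h0 : ⟪x, y⟫_ℂ = 0 := hs.2 (i := ⟨x, hx⟩) (j := ⟨y, hy⟩) fun h => hxy (congrArg Subtype.val h)
  have hx1 : ‖x‖ = 1 := hs.1 ⟨x, hx⟩
  have hy1 : ‖y‖ = 1 := hs.1 ⟨y, hy⟩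
  have h := norm_sub_sq (𝕜 := ℂ) x y
  rw [h0, hx1, hy1, ← dist_eq_norm] at h
  simp only [map_zero] at h
  nlinarith [dist_nonneg (x := x) (y := y)]

/-- A separable Hilbert space has a Hilbert basis with a countable index set in any universe. -/
theorem exists_countable_hilbertBasis (E : Type v) [NormedAddCommGroup E] [InnerProductSpace ℂ E]
    [CompleteSpace E] [TopologicalSpace.SeparableSpace E] :
    ∃ (N : Type w) (_ : Countable N), Nonempty (HilbertBasis N ℂ E) := by
  obtain ⟨s, b, hb⟩ := exists_hilbertBasis ℂ E
  have hs : Countable s := (countable_of_orthonormal (hb ▸ b.orthonormal)).to_subtype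
  have : Small.{w} s := Countable.toSmall s
  let e : Shrink.{w} s ≃ s := (equivShrink s).symm
  refine ⟨Shrink.{w} s, e.injective.countable, ⟨HilbertBasis.mk (v := b ∘ e)
    (b.orthonormal.comp e e.injective) ?_⟩⟩
  rw [e.surjective.range_comp, b.dense_span]

end Main

end GKLS

end

theorem mainTheorem1 {H : Type u} [NormedAddCommGroup H] [InnerProductSpace ℂ H] [CompleteSpace H]
    [TopologicalSpace.SeparableSpace H]
    (Φ : (H →L[ℂ] H) →ₗ[ℂ] (H →L[ℂ] H)) (hΦ : GKLS.IsNormalCP.{u, v} Φ)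
    (K : H →L[ℂ] H)
    (L : (H →L[ℂ] H) →ₗ[ℂ] (H →L[ℂ] H))
    (hL : ∀ X : H →L[ℂ] H, L X = Φ X - K.adjoint * X - X * K)
    (𝒜 : NonUnitalStarSubalgebra ℂ (H →L[ℂ] H))
    (hclosed : GKLS.IsWeaklyClosed 𝒜) (hAFD : GKLS.IsAFD 𝒜) :
    List.TFAE [
      -- invariance
      ∀ X ∈ 𝒜, L X ∈ 𝒜,
      -- every Stinespring representation of `Φ` gives the normal form
      ∀ (E : Type v) [NormedAddCommGroup E] [InnerProductSpace ℂ E] [CompleteSpace E]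
        [TopologicalSpace.SeparableSpace E] (V : H →L[ℂ] GKLS.HTensor H E),
        GKLS.IsStinespring Φ V → GKLS.StinespringForm 𝒜 V K,
      -- some Stinespring representation of `Φ` gives the normal form
      ∃ (E : Type v) (_ : NormedAddCommGroup E) (_ : InnerProductSpace ℂ E) (_ : CompleteSpace E)
        (_ : TopologicalSpace.SeparableSpace E) (V : H →L[ℂ] GKLS.HTensor H E),
        GKLS.IsStinespring Φ V ∧ GKLS.StinespringForm 𝒜 V K,
      -- every countable Kraus representation of `Φ` gives the normal form
      ∀ (N : Type w) [Countable N] (φ : N → H →L[ℂ] H),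
        GKLS.IsKraus Φ φ → GKLS.KrausForm 𝒜 φ K,
      -- some countable Kraus representation of `Φ` gives the normal form
      ∃ (N : Type w) (_ : Countable N) (φ : N → H →L[ℂ] H),
        GKLS.IsKraus Φ φ ∧ GKLS.KrausForm 𝒜 φ K] := by
  tfae_have 1 → 2 := fun h E _ _ _ _ V hV =>
    GKLS.stinespringForm_of_invariant hL hclosed hAFD h hV
  tfae_have 2 → 3 := fun h => by
    obtain ⟨E, i₁, i₂, i₃, i₄, V, hV⟩ := hΦ
    exact ⟨E, i₁, i₂, i₃, i₄, V, hV, h E V hV⟩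
  tfae_have 3 → 1 := fun ⟨E, _, _, _, _, V, hV, h⟩ =>
    GKLS.invariant_of_stinespringForm hL hV h
  -- This starts from invariance and not from the second statement: the auxiliary space `ℓ²(N)`
  -- lives in the universe of `N`, not in that of `E`.
  tfae_have 1 → 4 := fun h N _ φ hφ => by
    let b : HilbertBasis N ℂ (lp (fun _ : N => ℂ) 2) :=
      HilbertBasis.ofRepr (LinearIsometryEquiv.refl ℂ _)
    obtain ⟨V, hV, hVφ⟩ := hφ.exists_isStinespring b
    have h' := (GKLS.stinespringForm_of_invariant hL hclosed hAFD h hV).krausForm b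
    simp only [hVφ] at h'
    exact h'
  -- The components of the Stinespring operator from `hΦ` provide a countable Kraus representation.
  tfae_have 4 → 5 := fun h => by
    obtain ⟨E, _, _, _, _, V, hV⟩ := hΦ
    obtain ⟨N, hN, ⟨b⟩⟩ := GKLS.exists_countable_hilbertBasis.{v, w} E
    exact ⟨N, hN, _, hV.isKraus b, h N _ (hV.isKraus b)⟩
  tfae_have 5 → 1 := fun ⟨N, _, φ, hφ, h⟩ => GKLS.invariant_of_krausForm hL hφ h
  tfae_finish
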